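/- Let $V=\{1,\dots,n\}$ and let $G=(V,E)$, $E=E^+\cup E^-$, be a correlation clustering instance, where $G^+=(V,E^+)$ and $G^-=(V,E^-)$ are undirected graphs with nonnegative edge weights $w^+_{ij}=w^+_{ji}$ and $w^-_{ij}=w^-_{ji}$. The value of a clustering (partition) of $V$ is $$\mathcal C=\sum_{ij\in E^-}w^-_{ij}\,\mathbb 1[i,j\text{ in different clusters}]+\sum_{ij\in E^+}w^+_{ij}\,\mathbb 1[i,j\text{ in the same cluster}],$$ where the sums run over ordered pairs $(i,j)$ (each undirected edge is counted twice). Let $\mathrm{opt}^G_{CC}$ be the maximum of this value over all clusterings. Let $C=L_{G^-}+W^+$, with $L_{G^-}$ the weighted Laplacian of $G^-$ and $W^+$ the weighted adjacency matrix of $G^+$, and write $\langle A,B\rangle=\mathrm{Tr}(A^TB)$. Let $X^\star_G$ be an optimal solution of $$\max_{X\succeq0}\ \langle C,X\rangle\quad\text{subject to } X_{ii}=1\ (1\le i\le n),\quad X_{ij}\ge0\ \ ((i,j)\in E,\ i<j).$$ Let $\epsilon\in(0,1/6)$ and let $\widehat X\succeq0$ satisfy $(1-4\epsilon)\langle C,X^\star_G\rangle\le\langle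 C,\widehat X\rangle\le(1+4\epsilon)\langle C,X^\star_G\rangle$, $|\widehat X_{ii}-1|\le\epsilon$ for all $i$, and $\widehat X_{ij}\ge-\epsilon$ for $(i,j)\in E$, $i<j$. Repair: put $\mathrm{err}=\max\{0,\max_{(i,j)\in E,\,i<j}(-\widehat X_{ij})\}$ and $m=\max_i\widehat X_{ii}+\mathrm{err}$. For $l=1,2,3$ draw $z_l\sim\mathcal N(0,\widehat X)$, $y_l\sim\mathcal N(0,1)$ and $\zeta_l\sim\mathcal N\big(0,\,I-\mathrm{diag}^*\big((\widehat X_{ii}+\mathrm{err})/m\big)_i\big)$, all independent, where $\mathrm{diag}^*(x)$ is the diagonal matrix with the vector $x$ on its diagonal, and set $$z^f_l=\frac{z_l+\sqrt{\mathrm{err}}\;y_l\,\mathbb 1}{\sqrt m}+\zeta_l .$$ Charikar–Guruswami–Wirth (CGW) rounding: independently of everything else let $k=3$ with probability $0.1316$ and $k=2$ with probability $1-0.1316$; put vertices $i$ and $j$ in the same cluster if and only if, for every $l\le k$, $[z^f_l]_i$ and $[z^f_l]_j$ are both $\ge0$ or both $<0$ (at most $2^k$ clusters). Then the value $\mathcal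 C$ of the resulting clustering satisfies $$\mathbb E[\mathcal C]\ \ge\ 0.766(1-6\epsilon)\langle C,X^\star_G\rangle\ \ge\ 0.766(1-6\epsilon)\,\mathrm{opt}^G_{CC}.$$ -/

import Mathlib

open MeasureTheory ProbabilityTheory
open scoped Matrix

/-- An instance of correlation clustering on the vertex set `{0, …, n-1}`: two undirected graphs
(the edges labelled "similar" and the edges labelled "dissimilar") with nonnegative symmetric edge
weights. Values of the weight functions off the edges are never used. -/
structure CorrelationInstance (n : ℕ) where
  /-- The graph `G⁺` of similar pairs. -/
  plus : SimpleGraph (Fin n)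
  /-- The graph `G⁻` of dissimilar pairs. -/
  minus : SimpleGraph (Fin n)
  wPlus : Fin n → Fin n → ℝ
  wMinus : Fin n → Fin n → ℝ
  wPlus_symm : ∀ i j, wPlus i j = wPlus j i
  wMinus_symm : ∀ i j, wMinus i j = wMinus j i
  wPlus_nonneg : ∀ i j, plus.Adj i j → 0 ≤ wPlus i j
  wMinus_nonneg : ∀ i j, minus.Adj i j → 0 ≤ wMinus i j

namespace CorrelationInstance

variable {n : ℕ}

/-- The graph `G = (V, E)` with `E = E⁺ ∪ E⁻`. -/
def graph (G : CorrelationInstance n) : SimpleGraph (Fin n) := G.plus ⊔ G.minus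

open Classical in
/-- Weighted adjacency matrix `W⁺` of `G⁺`. -/
noncomputable def adjPlus (G : CorrelationInstance n) : Matrix (Fin n) (Fin n) ℝ :=
  Matrix.of fun i j => if G.plus.Adj i j then G.wPlus i j else 0

open Classical in
/-- Weighted adjacency matrix of `G⁻`. -/
noncomputable def adjMinus (G : CorrelationInstance n) : Matrix (Fin n) (Fin n) ℝ :=
  Matrix.of fun i j => if G.minus.Adj i j then G.wMinus i j else 0

/-- Weighted Laplacian of `G⁻`: the diagonal matrix of weighted degrees minus the weighted
adjacency matrix. -/
noncomputable def lapMinus (G : CorrelationInstance n) : Matrix (Fin n) (Fin n) ℝ :=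
  Matrix.diagonal (fun i => ∑ j, G.adjMinus i j) - G.adjMinus

/-- The cost matrix `C = L_{G⁻} + W⁺`. -/
noncomputable def cost (G : CorrelationInstance n) : Matrix (Fin n) (Fin n) ℝ :=
  G.lapMinus + G.adjPlus

open Classical in
/-- The agreement value of a clustering, a clustering being a partition of the vertex set,
i.e. an equivalence relation ("same cluster"): the weight of the dissimilar edges between
different clusters plus the weight of the similar edges inside clusters. The sums run over all
ordered pairs `(i, j)` that form an edge; this is the normalization for which the matrix of a
clustering `X i j = [i and j in the same cluster]` has `⟨C, X⟩` equal to the agreement value. -/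
noncomputable def agreement (G : CorrelationInstance n) (c : Setoid (Fin n)) : ℝ :=
  (∑ i, ∑ j, if G.minus.Adj i j ∧ ¬ c i j then G.wMinus i j else 0) +
    ∑ i, ∑ j, if G.plus.Adj i j ∧ c i j then G.wPlus i j else 0

/-- The optimal clustering value: the supremum of the agreement over the (finitely many)
clusterings. -/
noncomputable def opt (G : CorrelationInstance n) : ℝ := ⨆ c : Setoid (Fin n), G.agreement c

/-- Matrix inner product `⟨A, B⟩ = Tr(AᵀB)`. -/
def _root_.Matrix.traceInner (A B : Matrix (Fin n) (Fin n) ℝ) : ℝ := (Aᵀ * B).trace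

/-- Feasibility for the semidefinite relaxation: `X ⪰ 0`, unit diagonal, and nonnegative entries
on the edges of `G`. -/
structure Feasible (G : CorrelationInstance n) (X : Matrix (Fin n) (Fin n) ℝ) : Prop where
  posSemidef : X.PosSemidef
  diag_eq_one : ∀ i, X i i = 1
  edge_nonneg : ∀ i j, G.graph.Adj i j → i < j → 0 ≤ X i j

/-- `X` is an optimal solution of the semidefinite relaxation
`max ⟨C, X⟩` over the feasible matrices. -/
structure IsOptimalSolution (G : CorrelationInstance n) (X : Matrix (Fin n) (Fin n) ℝ) :
    Prop where
  feasible : G.Feasible X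
  le_of_feasible : ∀ Y, G.Feasible Y → G.cost.traceInner Y ≤ G.cost.traceInner X

open Classical in
/-- `err = max {0, max_{(i,j) ∈ E, i < j} -X i j}`. -/
noncomputable def err (G : CorrelationInstance n) (X : Matrix (Fin n) (Fin n) ℝ) : ℝ :=
  (insert 0 ((Finset.univ.filter fun p : Fin n × Fin n => G.graph.Adj p.1 p.2 ∧ p.1 < p.2).image
    fun p => -X p.1 p.2)).max' (Finset.insert_nonempty _ _)

/-- `max (diag X) + err`. -/
noncomputable def repairScale (G : CorrelationInstance n) (X : Matrix (Fin n) (Fin n) ℝ) : ℝ :=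
  (⨆ i, X i i) + G.err X

/-- Covariance of the correction noise: `I - diag* ((diag X + err) / (max (diag X) + err))`. -/
noncomputable def noiseCov (G : CorrelationInstance n) (X : Matrix (Fin n) (Fin n) ℝ) :
    Matrix (Fin n) (Fin n) ℝ :=
  1 - Matrix.diagonal fun i => (X i i + G.err X) / G.repairScale X

/-- One round of the modified repair algorithm: from a sample `z`, a real number `y` and a noise
vector `ζ` it returns `(z + √err · y · 𝟙) / √(max (diag X) + err) + ζ`. -/
noncomputable def repair (G : CorrelationInstance n) (X : Matrix (Fin n) (Fin n) ℝ)
    (z : EuclideanSpace ℝ (Fin n)) (y : ℝ) (ζ : EuclideanSpace ℝ (Fin n)) :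
    EuclideanSpace ℝ (Fin n) :=
  WithLp.toLp 2 fun i => (z i + √(G.err X) * y) / √(G.repairScale X) + ζ i

/-- The clustering cut out by the first `k` of three vectors: two vertices are in the same cluster
if and only if their coordinates have the same sign in each of the first `k` vectors
(at most `2 ^ k` clusters). -/
def signClustering (k : ℕ) (v : Fin 3 → EuclideanSpace ℝ (Fin n)) : Setoid (Fin n) where
  r i j := ∀ l : Fin 3, (l : ℕ) < k → (0 ≤ v l i ↔ 0 ≤ v l j)
  iseqv := ⟨fun _ _ _ => Iff.rfl, fun h l hl => (h l hl).symm,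
    fun h₁ h₂ l hl => (h₁ l hl).trans (h₂ l hl)⟩

/-- Law of the number of Gaussian samples used by the Charikar-Guruswami-Wirth rounding scheme:
`3` with probability `0.1316` and `2` with probability `1 - 0.1316`. -/
noncomputable def roundsLaw : Measure ℕ :=
  ENNReal.ofReal (1 - 0.1316) • Measure.dirac 2 + ENNReal.ofReal 0.1316 • Measure.dirac 3

/-- Joint law of all the randomness of the method with input covariance `X`, as a product measure
(so all parts are independent): three samples from `N(0, X)`; three samples from `N(0, 1)`; three
noise vectors with covariance `noiseCov`; the number of samples used in the rounding. -/
noncomputable def randomnessLaw (G : CorrelationInstance n) (X : Matrix (Fin n) (Fin n) ℝ) :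
    Measure ((Fin 3 → EuclideanSpace ℝ (Fin n)) × (Fin 3 → ℝ) ×
      (Fin 3 → EuclideanSpace ℝ (Fin n)) × ℕ) :=
  (Measure.pi fun _ => multivariateGaussian 0 X).prod
    ((Measure.pi fun _ => gaussianReal 0 1).prod
      ((Measure.pi fun _ => multivariateGaussian 0 (G.noiseCov X)).prod roundsLaw))

end CorrelationInstance

/-! Each vector $z^f_l$ is centred Gaussian with covariance $(\widehat X+\mathrm{err}\,J)/m+N$,
where $J$ is the all-ones matrix and $N$ is the diagonal noise covariance. This matrix has unit
diagonal, and its entry on an edge $ij$ is $\rho=(\widehat X_{ij}+\mathrm{err})/m\in[0,1]$. So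
$\rho=\cos\theta$ with $0\le\theta\le\pi/2$, and by Sheppard's formula one round keeps $i,j$
together with probability $1-\theta/\pi$ (`perturbed_sign_agree`). The rounds are independent, so
the pair shares a cluster with probability $p=0.8684(1-\theta/\pi)^2+0.1316(1-\theta/\pi)^3$.

Two one-variable inequalities, $p\ge0.766\cos\theta$ and $1-p\ge0.766(1-\cos\theta)$, then give the
guarantee edge by edge. Since $\langle C,X\rangle$ and the agreement are the same sum over ordered
pairs, summation yields $\mathbb E[\mathcal C]\ge0.766\,\langle C,\widehat X\rangle/m$
(`sum_sameCluster_ge`). Finally $m\le1+2\epsilon$ turns the factor $1-4\epsilon$ into $1-6\epsilon$,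
and the relaxation dominates `opt` because clustering matrices are feasible. -/

/-! ### Trigonometric inequalities for the rounding probabilities -/

/-- Bound behind the rounding of dissimilar pairs. -/
lemma one_sub_roundingProb_ge {θ : ℝ} (h0 : 0 ≤ θ) (h1 : θ ≤ Real.pi / 2) :
    0.766 * (1 - Real.cos θ) ≤
      1 - ((1 - 0.1316) * (1 - θ / Real.pi) ^ 2 + 0.1316 * (1 - θ / Real.pi) ^ 3) := by
  have hc := Real.one_sub_mul_le_cos h0 h1
  have hpi := Real.pi_pos
  set u := θ / Real.pi with hu
  have hu0 : 0 ≤ u := by positivity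
  have hu1 : u ≤ 1 / 2 := by rw [hu, div_le_iff₀ hpi]; linarith
  have : 2 / Real.pi * θ = 2 * u := by rw [hu]; ring
  rw [this] at hc
  -- Nearly tight at u = 1/2, where the two sides are 0.766 and 0.76645.
  nlinarith [mul_nonneg hu0 (sub_nonneg.2 hu1), mul_nonneg (mul_nonneg hu0 hu0) (sub_nonneg.2 hu1)]

/-- The cosine lies below its tangent on `[-π/2, π/2]`. -/
lemma cos_le_tangent {a x : ℝ} (ha : a ∈ Set.Ioo (-(Real.pi / 2)) (Real.pi / 2))
    (hx : x ∈ Set.Icc (-(Real.pi / 2)) (Real.pi / 2)) :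
    Real.cos x ≤ Real.cos a - Real.sin a * (x - a) := by
  have hcc := strictConcaveOn_cos_Icc.concaveOn
  have hd : HasDerivAt Real.cos (-Real.sin a) a := Real.hasDerivAt_cos a
  have ha' := Set.Ioo_subset_Icc_self ha
  rcases lt_trichotomy x a with h | rfl | h
  · have := hcc.le_slope_of_hasDerivAt hx ha' h hd
    rw [slope_def_field, le_div_iff₀ (by linarith)] at this
    linarith
  · simp
  · have := hcc.slope_le_of_hasDerivAt ha' hx h hd
    rw [slope_def_field, div_le_iff₀ (by linarith)] at this
    linarith

/-- Bound behind the rounding of similar pairs. -/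
lemma roundingProb_ge {θ : ℝ} (h0 : 0 ≤ θ) (h1 : θ ≤ Real.pi / 2) :
    0.766 * Real.cos θ ≤
      (1 - 0.1316) * (1 - θ / Real.pi) ^ 2 + 0.1316 * (1 - θ / Real.pi) ^ 3 := by
  have hpi := Real.pi_pos
  have hp1 := Real.pi_gt_d6
  have hp2 := Real.pi_lt_d6
  obtain ⟨u, rfl⟩ : ∃ u, θ = Real.pi * u := ⟨θ / Real.pi, by field_simp⟩
  have hu : Real.pi * u / Real.pi = u := by field_simp
  rw [hu]
  have hu0 : 0 ≤ u := by by_contra! h; nlinarith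
  have hu1 : u ≤ 1 / 2 := by by_contra! h; nlinarith
  -- The tangent point is u = 0.2275 = 1/4 - 0.0225, where both sides of the goal have almost the
  -- same slope in u, so their gap is about smallest there. Writing it as π/4 - t with small t lets
  -- Taylor bounds and √2 give the decimals.
  set t := Real.pi * 0.0225 with ht
  have ht1 : 0.070685 < t := by rw [ht]; linarith
  have ht2 : t < 0.070686 := by rw [ht]; linarith
  have htan := cos_le_tangent (a := Real.pi / 4 - t) (x := Real.pi * u)
    ⟨by linarith, by linarith⟩ ⟨by linarith, h1⟩
  rw [Real.cos_sub, Real.sin_sub, Real.cos_pi_div_four, Real.sin_pi_div_four] at htan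
  have habs : |t| = t := abs_of_pos (by linarith)
  have hcb := Real.cos_bound (x := t) (by rw [habs]; linarith)
  have hsb := Real.sin_bound (x := t) (by rw [habs]; linarith)
  rw [habs, abs_le] at hcb hsb
  have ht4 : t ^ 4 ≤ 0.000025 := by
    calc t ^ 4 ≤ 0.070686 ^ 4 := by gcongr
      _ ≤ _ := by norm_num
  have ht2l : 0.070685 ^ 2 ≤ t ^ 2 := by gcongr
  have ht2u : t ^ 2 ≤ 0.070686 ^ 2 := by gcongr
  have ht3l : 0.070685 ^ 3 ≤ t ^ 3 := by gcongr
  have ht3u : t ^ 3 ≤ 0.070686 ^ 3 := by gcongr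
  have ht5 : t ^ 5 ≤ 0.00001 := by
    calc t ^ 5 ≤ 0.070686 ^ 5 := by gcongr
      _ ≤ _ := by norm_num
  have hc1 : 0.99750 ≤ Real.cos t := by linarith [hcb.1]
  have hc2 : Real.cos t ≤ 0.997504 := by linarith [hcb.2]
  have hs1 : 0.070624 ≤ Real.sin t := by linarith [hsb.1]
  have hs2 : Real.sin t ≤ 0.070629 := by linarith [hsb.2]
  have hq1 : 1.414213 ≤ √2 := Real.le_sqrt_of_sq_le (by norm_num)
  have hq2 : √2 ≤ 1.414214 := Real.sqrt_le_iff.2 ⟨by norm_num, by norm_num⟩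
  set A := √2 / 2 * Real.cos t + √2 / 2 * Real.sin t with hA
  set B := √2 / 2 * Real.cos t - √2 / 2 * Real.sin t with hB
  have hA2 : A ≤ 0.75529 := by
    calc A = √2 / 2 * (Real.cos t + Real.sin t) := by rw [hA]; ring
      _ ≤ 1.414214 / 2 * (0.997504 + 0.070629) := by gcongr
      _ ≤ _ := by norm_num
  have hB1 : 0.65538 ≤ B := by
    calc (0.65538 : ℝ) ≤ 1.414213 / 2 * (0.99750 - 0.070629) := by norm_num
      _ ≤ √2 / 2 * (Real.cos t - Real.sin t) := by gcongr
      _ = B := by rw [hB]; ring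
  have hB2 : B ≤ 0.65541 := by
    calc B = √2 / 2 * (Real.cos t - Real.sin t) := by rw [hB]; ring
      _ ≤ 1.414214 / 2 * (0.997504 - 0.070624) := by gcongr; linarith
      _ ≤ _ := by norm_num
  have hx : Real.pi * u - (Real.pi / 4 - t) = Real.pi * (u - 0.2275) := by rw [ht]; ring
  rw [hx] at htan
  have hBp1 : 2.0589 ≤ B * Real.pi := by
    calc (2.0589 : ℝ) ≤ 0.65538 * 3.141592 := by norm_num
      _ ≤ _ := by gcongr
  have hBp2 : B * Real.pi ≤ 2.0591 := by
    calc B * Real.pi ≤ 0.65541 * 3.141593 := by gcongr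
      _ ≤ _ := by norm_num
  set D := B * Real.pi with hD
  have htan' : Real.cos (Real.pi * u) ≤ 0.75529 - D * (u - 0.2275) := by
    have : B * (Real.pi * (u - 0.2275)) = D * (u - 0.2275) := by rw [hD]; ring
    linarith
  -- Replacing `D` by 2.059 costs at most 0.0001 · |u - 0.2275|, well within the gap of about
  -- 0.00035 at the tangent point.
  have hlin : D * (u - 0.2275) ≥ 2.059 * (u - 0.2275) - 0.0001 * (1 / 2) := by
    rcases le_total u 0.2275 with h | h
    · linarith [mul_nonneg (sub_nonneg.2 h) (sub_nonneg.2 hBp2)]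
    · linarith [mul_nonneg (sub_nonneg.2 h) (sub_nonneg.2 hBp1)]
  -- The cubic is convex on [0, 1/2], hence lies above its tangent at 0.2275, which is almost
  -- parallel to the line bounding the cosine.
  nlinarith [mul_nonneg (sq_nonneg (u - 0.2275)) (sub_nonneg.2 hu1), sq_nonneg (u - 0.2275)]

/-! ### Sheppard's formula by polar coordinates -/

/-- A cone given by a set of angles has standard Gaussian measure proportional to the measure of
that set. -/
lemma gaussian_cone_measure (S : Set (ℝ × ℝ)) (hS : MeasurableSet S) (A : Set ℝ)
    (hA : MeasurableSet A)
    (h : ∀ r φ : ℝ, 0 < r → φ ∈ Set.Ioo (-Real.pi) Real.pi →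
      ((r * Real.cos φ, r * Real.sin φ) ∈ S ↔ φ ∈ A)) :
    ((gaussianReal 0 1).prod (gaussianReal 0 1)) S =
      (∫⁻ r in Set.Ioi (0 : ℝ), ENNReal.ofReal r *
        ENNReal.ofReal ((2 * Real.pi)⁻¹ * Real.exp (-r ^ 2 / 2))) *
      volume (A ∩ Set.Ioo (-Real.pi) Real.pi) := by
  have hm : Measurable (gaussianPDF 0 1) := measurable_gaussianPDF 0 1
  rw [gaussianReal_of_var_ne_zero _ one_ne_zero, prod_withDensity hm hm, withDensity_apply _ hS,
    ← lintegral_indicator hS, ← Measure.volume_eq_prod, ← lintegral_comp_polarCoord_symm]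
  have hset : polarCoord.target = Set.Ioi (0 : ℝ) ×ˢ Set.Ioo (-Real.pi) Real.pi := rfl
  -- The Gaussian density is rotation invariant, so the integrand splits into a radial and an
  -- angular factor.
  have hcongr : ∀ p ∈ polarCoord.target,
      ENNReal.ofReal p.1 • S.indicator (fun z : ℝ × ℝ => gaussianPDF 0 1 z.1 * gaussianPDF 0 1 z.2)
        (polarCoord.symm p) =
      (ENNReal.ofReal p.1 * ENNReal.ofReal ((2 * Real.pi)⁻¹ * Real.exp (-p.1 ^ 2 / 2))) *
        A.indicator 1 p.2 := by
    rintro ⟨r, φ⟩ ⟨hr, hφ⟩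
    have := h r φ hr hφ
    rw [polarCoord_symm_apply]
    by_cases hmem : φ ∈ A
    · rw [Set.indicator_of_mem (this.2 hmem), Set.indicator_of_mem hmem]
      simp only [smul_eq_mul, Pi.one_apply, mul_one]
      congr 1
      rw [gaussianPDF, gaussianPDF, ← ENNReal.ofReal_mul (gaussianPDFReal_nonneg _ _ _)]
      congr 1
      simp only [gaussianPDFReal, NNReal.coe_one, mul_one, sub_zero]
      have hs : (√(2 * Real.pi))⁻¹ * (√(2 * Real.pi))⁻¹ = (2 * Real.pi)⁻¹ := by
        rw [← mul_inv, Real.mul_self_sqrt (by positivity)]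
      rw [mul_mul_mul_comm, hs, ← Real.exp_add]
      congr 2
      have := Real.sin_sq_add_cos_sq φ
      linear_combination (-r ^ 2 / 2) * this
    · rw [Set.indicator_of_notMem (mt this.1 hmem), Set.indicator_of_notMem hmem]
      simp
  rw [setLIntegral_congr_fun (polarCoord.open_target.measurableSet) hcongr, hset,
    Measure.volume_eq_prod, ← Measure.prod_restrict,
    lintegral_prod_mul (f := fun r : ℝ => ENNReal.ofReal r *
      ENNReal.ofReal ((2 * Real.pi)⁻¹ * Real.exp (-r ^ 2 / 2))) (g := A.indicator 1)]
  · rw [lintegral_indicator_one hA, Measure.restrict_apply hA]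
  · fun_prop
  · exact (measurable_one.indicator hA).aemeasurable

/-- Sheppard's formula for acute angles: two standard Gaussians with correlation `cos θ` have the same
sign with probability `1 - θ / π`. -/
lemma gaussian_sign_agree {θ : ℝ} (h0 : 0 ≤ θ) (h1 : θ ≤ Real.pi / 2) :
    ((gaussianReal 0 1).prod (gaussianReal 0 1)).real
      {p : ℝ × ℝ | 0 ≤ p.1 ↔ 0 ≤ Real.cos θ * p.1 + Real.sin θ * p.2} = 1 - θ / Real.pi := by
  have hpi := Real.pi_pos
  set S : Set (ℝ × ℝ) := {p | 0 ≤ p.1 ↔ 0 ≤ Real.cos θ * p.1 + Real.sin θ * p.2} with hSdef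
  -- The angles of disagreement: the second form equals r cos(φ - θ), so its half-plane is that of
  -- the first rotated by θ.
  set A : Set ℝ := Set.Ico (-(Real.pi / 2)) (θ - Real.pi / 2) ∪
    Set.Ioc (Real.pi / 2) (θ + Real.pi / 2) with hAdef
  have hSm : MeasurableSet S := by
    have e1 : MeasurableSet {p : ℝ × ℝ | 0 ≤ p.1} := measurableSet_le (by fun_prop) (by fun_prop)
    have e2 : MeasurableSet {p : ℝ × ℝ | 0 ≤ Real.cos θ * p.1 + Real.sin θ * p.2} :=
      measurableSet_le (by fun_prop) (by fun_prop)
    exact e1.iff e2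
  have hAm : MeasurableSet A := measurableSet_Ico.union measurableSet_Ioc
  have hcos : ∀ x, -(3 * Real.pi / 2) < x → x < 3 * Real.pi / 2 →
      (0 ≤ Real.cos x ↔ -(Real.pi / 2) ≤ x ∧ x ≤ Real.pi / 2) := by
    intro x hx1 hx2
    refine ⟨fun hc => ⟨?_, ?_⟩, fun hx => Real.cos_nonneg_of_neg_pi_div_two_le_of_le hx.1 hx.2⟩
    · by_contra! hlt
      have := Real.cos_neg_of_pi_div_two_lt_of_lt (x := -x) (by linarith) (by linarith)
      rw [Real.cos_neg] at this
      linarith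
    · by_contra! hlt
      have := Real.cos_neg_of_pi_div_two_lt_of_lt hlt (by linarith)
      linarith
  have key := gaussian_cone_measure Sᶜ hSm.compl A hAm (by
    intro r φ hr ⟨hφ1, hφ2⟩
    have e1 : 0 ≤ r * Real.cos φ ↔ 0 ≤ Real.cos φ := mul_nonneg_iff_of_pos_left hr
    have e2 : 0 ≤ Real.cos θ * (r * Real.cos φ) + Real.sin θ * (r * Real.sin φ) ↔
        0 ≤ Real.cos (φ - θ) := by
      rw [← mul_nonneg_iff_of_pos_left (b := Real.cos (φ - θ)) hr, Real.cos_sub]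
      ring_nf
    simp only [hSdef, hAdef, Set.mem_compl_iff, Set.mem_ofPred_eq, e1, e2, Set.mem_union,
      Set.mem_Ico, Set.mem_Ioc]
    rw [hcos φ (by linarith) (by linarith), hcos (φ - θ) (by linarith) (by linarith)]
    constructor
    · intro hne
      by_contra! hcon
      apply hne
      constructor
      · rintro ⟨a, b⟩
        exact ⟨by linarith [hcon.1 a], by linarith⟩
      · rintro ⟨a, b⟩
        refine ⟨by linarith, ?_⟩
        by_contra! hlt
        linarith [hcon.2 hlt]
    · rintro (⟨a, b⟩ | ⟨a, b⟩) hiff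
      · linarith [(hiff.1 ⟨a, by linarith⟩).1]
      · linarith [(hiff.2 ⟨by linarith, by linarith⟩).2])
  -- The radial integral is never computed: the total mass 1 determines it.
  have total := gaussian_cone_measure Set.univ MeasurableSet.univ Set.univ MeasurableSet.univ
    (by simp)
  rw [Set.univ_inter, Real.volume_Ioo, measure_univ] at total
  set K := ∫⁻ r in Set.Ioi (0 : ℝ), ENNReal.ofReal r *
        ENNReal.ofReal ((2 * Real.pi)⁻¹ * Real.exp (-r ^ 2 / 2))
  have hvol : volume (A ∩ Set.Ioo (-Real.pi) Real.pi) = ENNReal.ofReal (2 * θ) := by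
    have hAe : A =ᵐ[volume] (Set.Ioo (-(Real.pi / 2)) (θ - Real.pi / 2) ∪
        Set.Ioo (Real.pi / 2) (θ + Real.pi / 2) : Set ℝ) :=
      Ioo_ae_eq_Ico.symm.union Ioo_ae_eq_Ioc.symm
    have hsub : (Set.Ioo (-(Real.pi / 2)) (θ - Real.pi / 2) ∪
        Set.Ioo (Real.pi / 2) (θ + Real.pi / 2) : Set ℝ) ⊆ Set.Ioo (-Real.pi) Real.pi := by
      rintro x (⟨a, b⟩ | ⟨a, b⟩) <;> constructor <;> linarith
    have hAe' : (A ∩ Set.Ioo (-Real.pi) Real.pi : Set ℝ) =ᵐ[volume]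
        ((Set.Ioo (-(Real.pi / 2)) (θ - Real.pi / 2) ∪
        Set.Ioo (Real.pi / 2) (θ + Real.pi / 2)) ∩ Set.Ioo (-Real.pi) Real.pi : Set ℝ) :=
      hAe.inter (ae_eq_refl _)
    rw [measure_congr hAe', Set.inter_eq_left.2 hsub,
      measure_union _ measurableSet_Ioo, Real.volume_Ioo, Real.volume_Ioo,
      ← ENNReal.ofReal_add (by linarith) (by linarith)]
    · congr 1; ring
    · rw [Set.disjoint_left]
      rintro x ⟨a, b⟩ ⟨c, d⟩
      linarith
  rw [hvol] at key
  have hK : K.toReal * (2 * Real.pi) = 1 := by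
    have := congrArg ENNReal.toReal total
    rw [ENNReal.toReal_mul, ENNReal.toReal_ofReal (by linarith), ENNReal.toReal_one] at this
    linarith
  have hc : ((gaussianReal 0 1).prod (gaussianReal 0 1)).real Sᶜ = θ / Real.pi := by
    rw [Measure.real, key, ENNReal.toReal_mul, ENNReal.toReal_ofReal (by linarith)]
    field_simp
    linear_combination θ * hK
  rw [probReal_compl_eq_one_sub hSm] at hc
  linarith

/-! ### Joint law of two coordinates, by characteristic functions -/

lemma charFunDual_gaussianReal (L : StrongDual ℝ ℝ) :
    charFunDual (gaussianReal 0 1) L = Complex.exp (((-(L 1) ^ 2 / 2 : ℝ)) : ℂ) := by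
  have hL : L = (L 1) • ContinuousLinearMap.id ℝ ℝ := by ext; simp
  conv_lhs => rw [hL]
  rw [← charFun_map_eq_charFunDual_smul, ContinuousLinearMap.coe_id', Measure.map_id,
    charFun_gaussianReal]
  push_cast
  simp
  ring_nf

/-- The functional is the inner product with a e_i + b e_j, so the quadratic form sees only the
entries of `S` indexed by i and j. -/
lemma charFunDual_multivariateGaussian_pair {ι : Type*} [Fintype ι] [DecidableEq ι]
    {S : Matrix ι ι ℝ} (hS : S.PosSemidef) (i j : ι) (a b : ℝ)
    (L : StrongDual ℝ (EuclideanSpace ℝ ι)) (hL : ∀ v, L v = a * v i + b * v j) :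
    charFunDual (multivariateGaussian 0 S) L =
      Complex.exp ((-(a ^ 2 * S i i + 2 * a * b * S i j + b ^ 2 * S j j) / 2 : ℝ) : ℂ) := by
  have hs : S j i = S i j := by simpa using hS.1.apply i j
  set w : EuclideanSpace ℝ ι := EuclideanSpace.single i a + EuclideanSpace.single j b with hw
  have hLw : L = InnerProductSpace.toDualMap ℝ _ w := by
    ext v
    simp [hL, hw, EuclideanSpace.inner_single_left]
  rw [hLw, ← charFun_eq_charFunDual_toDualMap, charFun_multivariateGaussian hS]
  have : w.ofLp ⬝ᵥ S *ᵥ w.ofLp = a ^ 2 * S i i + 2 * a * b * S i j + b ^ 2 * S j j := by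
    simp only [hw, WithLp.ofLp_add, PiLp.ofLp_single, Matrix.mulVec_add,
      add_dotProduct, dotProduct_add, Matrix.mulVec_single, single_dotProduct]
    simp [hs]
    ring
  rw [this]
  simp
  ring_nf

/-- Two coordinates of a shifted, scaled and perturbed Gaussian vector are jointly distributed as a
standard bivariate Gaussian with correlation `cos θ`, provided the covariances match. -/
lemma map_pair_gaussian {ι : Type*} [Fintype ι] [DecidableEq ι]
    {X N : Matrix ι ι ℝ} (hX : X.PosSemidef) (hN : N.PosSemidef) (i j : ι) (s M θ : ℝ)
    (hi : (X i i + s ^ 2) / M ^ 2 + N i i = 1) (hj : (X j j + s ^ 2) / M ^ 2 + N j j = 1)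
    (hij : (X i j + s ^ 2) / M ^ 2 + N i j = Real.cos θ) :
    ((multivariateGaussian 0 X).prod ((gaussianReal 0 1).prod (multivariateGaussian 0 N))).map
      (fun p => ((p.1 i + s * p.2.1) / M + p.2.2 i, (p.1 j + s * p.2.1) / M + p.2.2 j)) =
    ((gaussianReal 0 1).prod (gaussianReal 0 1)).map
      (fun p => (p.1, Real.cos θ * p.1 + Real.sin θ * p.2)) := by
  let T (k : ι) : EuclideanSpace ℝ ι × ℝ × EuclideanSpace ℝ ι →L[ℝ] ℝ :=
    M⁻¹ • ((EuclideanSpace.proj k).comp (.fst ℝ _ _) +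
      s • (ContinuousLinearMap.fst ℝ _ _).comp (.snd ℝ _ _)) +
      ((EuclideanSpace.proj k).comp (.snd ℝ _ _)).comp (.snd ℝ _ _)
  have hT : (fun p : EuclideanSpace ℝ ι × ℝ × EuclideanSpace ℝ ι =>
      ((p.1 i + s * p.2.1) / M + p.2.2 i, (p.1 j + s * p.2.1) / M + p.2.2 j)) =
      ((T i).prod (T j)) := by
    ext p <;> simp [T] <;> ring
  let R : ℝ × ℝ →L[ℝ] ℝ × ℝ := (ContinuousLinearMap.fst ℝ ℝ ℝ).prod
    (Real.cos θ • ContinuousLinearMap.fst ℝ ℝ ℝ + Real.sin θ • ContinuousLinearMap.snd ℝ ℝ ℝ)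
  have hR : (fun p : ℝ × ℝ => (p.1, Real.cos θ * p.1 + Real.sin θ * p.2)) = R := by
    ext p <;> simp [R]
  rw [hT, hR]
  have : IsProbabilityMeasure (((multivariateGaussian 0 X).prod
      ((gaussianReal 0 1).prod (multivariateGaussian 0 N))).map ((T i).prod (T j))) :=
    Measure.isProbabilityMeasure_map (by fun_prop)
  have : IsProbabilityMeasure (((gaussianReal 0 1).prod (gaussianReal 0 1)).map R) :=
    Measure.isProbabilityMeasure_map (by fun_prop)
  apply Measure.ext_of_charFunDual
  ext L
  have hLpq : ∀ u v, L (u, v) = u * L (1, 0) + v * L (0, 1) := by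
    intro u v
    have : ((u, v) : ℝ × ℝ) = u • (1, 0) + v • (0, 1) := by simp
    rw [this, map_add, map_smul, map_smul, smul_eq_mul, smul_eq_mul]
  set p := L (1, 0)
  set q := L (0, 1)
  rw [charFunDual_map, charFunDual_map, charFunDual_prod, charFunDual_prod, charFunDual_prod,
    charFunDual_multivariateGaussian_pair hX i j (p / M) (q / M),
    charFunDual_multivariateGaussian_pair hN i j p q, charFunDual_gaussianReal,
    charFunDual_gaussianReal, charFunDual_gaussianReal, ← Complex.exp_add, ← Complex.exp_add,
    ← Complex.exp_add, ← Complex.ofReal_add, ← Complex.ofReal_add, ← Complex.ofReal_add]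
  · congr 2
    simp only [ContinuousLinearMap.comp_apply, ContinuousLinearMap.inl_apply,
      ContinuousLinearMap.inr_apply, ContinuousLinearMap.prod_apply, T, R, hLpq]
    simp
    have hsc := Real.sin_sq_add_cos_sq θ
    -- Comparison of the quadratic forms in p, q: the coefficients of p², q² and pq are the two
    -- variances and the covariance.
    linear_combination (-p ^ 2 / 2) * hi - q ^ 2 / 2 * hj - p * q * hij + q ^ 2 / 2 * hsc
  · intro v
    simp [T, hLpq]; ring
  · intro v
    simp [T, hLpq]; ring

/-- Probability that two coordinates of the perturbed Gaussian vector have the same sign. -/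
lemma perturbed_sign_agree {ι : Type*} [Fintype ι] [DecidableEq ι]
    {X N : Matrix ι ι ℝ} (hX : X.PosSemidef) (hN : N.PosSemidef) (i j : ι) (s M θ : ℝ)
    (hi : (X i i + s ^ 2) / M ^ 2 + N i i = 1) (hj : (X j j + s ^ 2) / M ^ 2 + N j j = 1)
    (hij : (X i j + s ^ 2) / M ^ 2 + N i j = Real.cos θ)
    (h0 : 0 ≤ θ) (h1 : θ ≤ Real.pi / 2) :
    ((multivariateGaussian 0 X).prod ((gaussianReal 0 1).prod (multivariateGaussian 0 N))).real
      {p | 0 ≤ (p.1 i + s * p.2.1) / M + p.2.2 i ↔ 0 ≤ (p.1 j + s * p.2.1) / M + p.2.2 j} =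
      1 - θ / Real.pi := by
  rw [← gaussian_sign_agree h0 h1]
  have hm : MeasurableSet {x : ℝ × ℝ | 0 ≤ x.1 ↔ 0 ≤ x.2} :=
    (measurableSet_le measurable_const measurable_fst).iff
      (measurableSet_le measurable_const measurable_snd)
  have := congrArg (fun μ : Measure (ℝ × ℝ) => μ.real {x : ℝ × ℝ | 0 ≤ x.1 ↔ 0 ≤ x.2})
    (map_pair_gaussian hX hN i j s M θ hi hj hij)
  simp only at this
  rwa [map_measureReal_apply (by fun_prop) hm, map_measureReal_apply (by fun_prop) hm] at this

/-! ### Independent rounds and their random number -/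

/-- Probability that the first `k` of the independent triples all lie in `S`. -/
lemma measure_pi_triple_forall_lt {α β γ : Type*} [MeasurableSpace α] [MeasurableSpace β]
    [MeasurableSpace γ] (μ : Measure α) (ν : Measure β) (ρ : Measure γ) [IsProbabilityMeasure μ]
    [IsProbabilityMeasure ν] [IsProbabilityMeasure ρ] {m : ℕ} {S : Set (α × β × γ)}
    (hS : MeasurableSet S) {k : ℕ} (hk : k ≤ m) :
    ((Measure.pi fun _ : Fin m => μ).prod ((Measure.pi fun _ : Fin m => ν).prod
      (Measure.pi fun _ : Fin m => ρ))).real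
      {x | ∀ l : Fin m, (l : ℕ) < k → (x.1 l, x.2.1 l, x.2.2 l) ∈ S} =
      (μ.prod (ν.prod ρ)).real S ^ k := by
  have h1 := measurePreserving_arrowProdEquivProdArrow α (β × γ) (Fin m) (fun _ => μ)
    (fun _ => ν.prod ρ)
  have h2 := (MeasurePreserving.id (Measure.pi fun _ : Fin m => μ)).prod
    (measurePreserving_arrowProdEquivProdArrow β γ (Fin m) (fun _ => ν) (fun _ => ρ))
  have h := h2.comp h1
  have hE : MeasurableSet {x : (Fin m → α) × (Fin m → β) × (Fin m → γ) |
      ∀ l : Fin m, (l : ℕ) < k → (x.1 l, x.2.1 l, x.2.2 l) ∈ S} := by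
    rw [Set.ofPred_forall]
    refine MeasurableSet.iInter fun l => MeasurableSet.imp (.const _) ?_
    exact hS.preimage (by fun_prop)
  rw [← h.measureReal_preimage hE.nullMeasurableSet]
  -- After regrouping the samples by round the event is a box, with no constraint in the rounds l ≥
  -- k.
  have : (Prod.map id (MeasurableEquiv.arrowProdEquivProdArrow β γ (Fin m)) ∘
      (MeasurableEquiv.arrowProdEquivProdArrow α (β × γ) (Fin m))) ⁻¹'
      {x | ∀ l : Fin m, (l : ℕ) < k → (x.1 l, x.2.1 l, x.2.2 l) ∈ S} =
      Set.univ.pi fun l : Fin m => if (l : ℕ) < k then S else Set.univ := by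
    ext x
    simp only [Set.mem_preimage, Set.mem_ofPred_eq, Set.mem_pi, Set.mem_univ, true_imp_iff]
    refine forall_congr' fun l => ?_
    split_ifs with hl
    · simp only [hl, true_imp_iff]; rfl
    · simp [hl]
  rw [this, measureReal_def, Measure.pi_pi, ENNReal.toReal_prod]
  have hl : ∀ l : Fin m, ((μ.prod (ν.prod ρ)) (if (l : ℕ) < k then S else Set.univ)).toReal =
      if (l : ℕ) < k then (μ.prod (ν.prod ρ)).real S else 1 := by
    intro l
    split_ifs <;> simp [measureReal_def]
  simp_rw [hl]
  rw [Fin.prod_univ_eq_prod_range (fun l => if l < k then (μ.prod (ν.prod ρ)).real S else 1) m,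
    ← Finset.prod_filter, Finset.prod_const]
  congr 1
  have : (Finset.range m).filter (· < k) = Finset.range k := by
    ext x; simp; omega
  rw [this, Finset.card_range]

namespace CorrelationInstance

/-- Mixture over the number of rounds. -/
lemma prod_roundsLaw_real {α β γ : Type*} [MeasurableSpace α] [MeasurableSpace β]
    [MeasurableSpace γ] (μ : Measure α) (ν : Measure β) (ρ : Measure γ) [IsProbabilityMeasure μ]
    [IsProbabilityMeasure ν] [IsProbabilityMeasure ρ] {E : Set (α × β × γ × ℕ)}
    (hE : MeasurableSet E) :
    (μ.prod (ν.prod (ρ.prod roundsLaw))).real E =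
      (1 - 0.1316) * (μ.prod (ν.prod ρ)).real {x | (x.1, x.2.1, x.2.2, 2) ∈ E} +
        0.1316 * (μ.prod (ν.prod ρ)).real {x | (x.1, x.2.1, x.2.2, 3) ∈ E} := by
  have hd : ∀ k : ℕ, μ.prod (ν.prod (ρ.prod (Measure.dirac k))) =
      (μ.prod (ν.prod ρ)).map (fun x => (x.1, x.2.1, x.2.2, k)) := by
    intro k
    have e1 : ν.prod (ρ.prod (Measure.dirac k)) =
        (ν.prod ρ).map (Prod.map id (fun c => (c, k))) := by
      rw [Measure.prod_dirac, ← Measure.map_prod_map _ _ measurable_id (by fun_prop),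
        Measure.map_id]
    rw [e1]
    conv_lhs => rw [← Measure.map_id (μ := μ)]
    rw [Measure.map_prod_map _ _ measurable_id (by fun_prop)]
    rfl
  have hr : ∀ k : ℕ, (μ.prod (ν.prod (ρ.prod (Measure.dirac k)))).real E =
      (μ.prod (ν.prod ρ)).real {x | (x.1, x.2.1, x.2.2, k) ∈ E} := by
    intro k
    rw [hd, map_measureReal_apply (by fun_prop) hE]
    rfl
  rw [← hr, ← hr, roundsLaw, Measure.prod_add, Measure.prod_smul_right, Measure.prod_smul_right,
    Measure.prod_add, Measure.prod_smul_right, Measure.prod_smul_right, Measure.prod_add,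
    Measure.prod_smul_right, Measure.prod_smul_right, measureReal_add_apply
      (ENNReal.mul_ne_top ENNReal.ofReal_ne_top (measure_ne_top _ _))
      (ENNReal.mul_ne_top ENNReal.ofReal_ne_top (measure_ne_top _ _)),
    measureReal_ennreal_smul_apply, measureReal_ennreal_smul_apply,
    ENNReal.toReal_ofReal (by norm_num), ENNReal.toReal_ofReal (by norm_num)]

variable {n : ℕ}

/-- Event that `i` and `j` get the same cluster. -/
def sameClusterSet (G : CorrelationInstance n) (X : Matrix (Fin n) (Fin n) ℝ) (i j : Fin n) :
    Set ((Fin 3 → EuclideanSpace ℝ (Fin n)) × (Fin 3 → ℝ) ×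
      (Fin 3 → EuclideanSpace ℝ (Fin n)) × ℕ) :=
  {x | signClustering x.2.2.2 (fun l => G.repair X (x.1 l) (x.2.1 l) (x.2.2.1 l)) i j}

lemma mem_sameClusterSet (G : CorrelationInstance n) (X : Matrix (Fin n) (Fin n) ℝ) (i j : Fin n)
    (x : (Fin 3 → EuclideanSpace ℝ (Fin n)) × (Fin 3 → ℝ) ×
      (Fin 3 → EuclideanSpace ℝ (Fin n)) × ℕ) :
    x ∈ G.sameClusterSet X i j ↔ ∀ l : Fin 3, (l : ℕ) < x.2.2.2 →
      (0 ≤ (x.1 l i + √(G.err X) * x.2.1 l) / √(G.repairScale X) + x.2.2.1 l i ↔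
        0 ≤ (x.1 l j + √(G.err X) * x.2.1 l) / √(G.repairScale X) + x.2.2.1 l j) := Iff.rfl

lemma measurableSet_sign_agree {ι : Type*} [Fintype ι] (i j : ι) (s M : ℝ) :
    MeasurableSet {p : EuclideanSpace ℝ ι × ℝ × EuclideanSpace ℝ ι |
      0 ≤ (p.1 i + s * p.2.1) / M + p.2.2 i ↔ 0 ≤ (p.1 j + s * p.2.1) / M + p.2.2 j} :=
  (measurableSet_le measurable_const (by fun_prop)).iff
    (measurableSet_le measurable_const (by fun_prop))

lemma measurableSet_sameClusterSet (G : CorrelationInstance n) (X : Matrix (Fin n) (Fin n) ℝ)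
    (i j : Fin n) : MeasurableSet (G.sameClusterSet X i j) := by
  have : G.sameClusterSet X i j = {x | ∀ l : Fin 3, (l : ℕ) < x.2.2.2 →
      (x.1 l, x.2.1 l, x.2.2.1 l) ∈ {p : EuclideanSpace ℝ (Fin n) × ℝ × EuclideanSpace ℝ (Fin n) |
        0 ≤ (p.1 i + √(G.err X) * p.2.1) / √(G.repairScale X) + p.2.2 i ↔
        0 ≤ (p.1 j + √(G.err X) * p.2.1) / √(G.repairScale X) + p.2.2 j}} := rfl
  rw [this, Set.ofPred_forall]
  refine MeasurableSet.iInter fun l => MeasurableSet.imp ?_ ?_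
  · exact measurableSet_lt measurable_const (by fun_prop)
  · exact (measurableSet_sign_agree i j _ _).preimage (by fun_prop)

/-- Probability that two vertices end up in the same cluster. -/
lemma randomnessLaw_sameClusterSet (G : CorrelationInstance n) {X : Matrix (Fin n) (Fin n) ℝ}
    (hX : X.PosSemidef) (hN : (G.noiseCov X).PosSemidef) (hm : 0 < G.repairScale X)
    (he : 0 ≤ G.err X) {i j : Fin n} (hij : i ≠ j)
    {θ : ℝ} (h0 : 0 ≤ θ) (h1 : θ ≤ Real.pi / 2)
    (hθ : (X i j + G.err X) / G.repairScale X = Real.cos θ) :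
    (G.randomnessLaw X).real (G.sameClusterSet X i j) =
      (1 - 0.1316) * (1 - θ / Real.pi) ^ 2 + 0.1316 * (1 - θ / Real.pi) ^ 3 := by
  rw [randomnessLaw, prod_roundsLaw_real _ _ _ (G.measurableSet_sameClusterSet X i j)]
  -- The noise raises each variance to 1 and, being diagonal, leaves the covariance of i ≠ j
  -- unchanged.
  have hp := perturbed_sign_agree hX hN i j (√(G.err X)) (√(G.repairScale X)) θ
    (by simp [noiseCov, Real.sq_sqrt he, Real.sq_sqrt hm.le])
    (by simp [noiseCov, Real.sq_sqrt he, Real.sq_sqrt hm.le])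
    (by simp [noiseCov, Real.sq_sqrt he, Real.sq_sqrt hm.le, hij, hθ]) h0 h1
  rw [← hp, ← measure_pi_triple_forall_lt _ _ _ (measurableSet_sign_agree i j _ _)
      (by norm_num : 2 ≤ 3),
    ← measure_pi_triple_forall_lt _ _ _ (measurableSet_sign_agree i j _ _) (le_refl 3)]
  rfl

end CorrelationInstance

/-! ### The semidefinite relaxation and the repaired matrix -/

/-- Test positivity on e_i - e_j. This keeps the repaired correlations at most 1. -/
lemma Matrix.PosSemidef.two_mul_apply_le {ι : Type*} [Finite ι]
    {X : Matrix ι ι ℝ} (hX : X.PosSemidef) (i j : ι) : 2 * X i j ≤ X i i + X j j := by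
  classical
  have := Fintype.ofFinite ι
  have hs : X j i = X i j := by simpa using hX.1.apply i j
  have := hX.dotProduct_mulVec_nonneg (Pi.single i 1 - Pi.single j 1)
  simp [Matrix.mulVec_sub, sub_dotProduct, dotProduct_sub, hs] at this
  linarith

namespace CorrelationInstance

variable {n : ℕ} (G : CorrelationInstance n)

lemma adjPlus_nonneg (i j : Fin n) : 0 ≤ G.adjPlus i j := by
  simp only [adjPlus, Matrix.of_apply]
  split_ifs with h
  · exact G.wPlus_nonneg i j h
  · exact le_rfl

lemma adjMinus_nonneg (i j : Fin n) : 0 ≤ G.adjMinus i j := by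
  simp only [adjMinus, Matrix.of_apply]
  split_ifs with h
  · exact G.wMinus_nonneg i j h
  · exact le_rfl

/-- Distributing the degrees of the Laplacian over the edges gives a sum over ordered pairs, the
form in which the agreement is compared with it. -/
lemma cost_traceInner (X : Matrix (Fin n) (Fin n) ℝ) :
    G.cost.traceInner X =
      ∑ i, ∑ j, (G.adjMinus i j * (X i i - X i j) + G.adjPlus i j * X i j) := by
  have h1 : G.cost.traceInner X = ∑ i, ∑ j, G.cost i j * X i j := by
    simp only [Matrix.traceInner, Matrix.trace, Matrix.diag_apply, Matrix.mul_apply,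
      Matrix.transpose_apply]
    exact Finset.sum_comm
  rw [h1]
  refine Finset.sum_congr rfl fun i _ => ?_
  simp only [cost, lapMinus, Matrix.add_apply, Matrix.sub_apply, Matrix.diagonal_apply, add_mul,
    sub_mul, ite_mul, zero_mul, Finset.sum_add_distrib, Finset.sum_sub_distrib, mul_sub,
    Finset.sum_ite_eq, Finset.mem_univ, if_true, Finset.sum_mul]

open Classical in
lemma agreement_eq_sum (c : Setoid (Fin n)) :
    G.agreement c = ∑ i, ∑ j, (G.adjMinus i j * (1 - if c i j then 1 else 0) +
      G.adjPlus i j * if c i j then 1 else 0) := by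
  simp only [agreement, adjMinus, adjPlus, Matrix.of_apply, ← Finset.sum_add_distrib]
  refine Finset.sum_congr rfl fun i _ => Finset.sum_congr rfl fun j _ => ?_
  by_cases h1 : c i j <;> by_cases h2 : G.minus.Adj i j <;> by_cases h3 : G.plus.Adj i j <;>
    simp [h1, h2, h3]

open Classical in
/-- The matrix of a clustering is feasible. -/
lemma feasible_clustering (c : Setoid (Fin n)) :
    G.Feasible (Matrix.of fun i j => if c i j then 1 else 0) where
  posSemidef := by
    -- A Gram matrix: each vertex is sent to the basis vector of the chosen representative of its
    -- cluster.
    have : (Matrix.of fun i j => if c i j then 1 else 0 : Matrix (Fin n) (Fin n) ℝ) =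
        (Matrix.of fun (i : Fin n) (q : Fin n) => if Quotient.out (Quotient.mk c i) = q then
          (1 : ℝ) else 0) *
        (Matrix.of fun (i : Fin n) (q : Fin n) => if Quotient.out (Quotient.mk c i) = q then
          (1 : ℝ) else 0)ᴴ := by
      ext i j
      have : c i j ↔ Quotient.mk c j = Quotient.mk c i := by
        rw [Quotient.eq]
        exact ⟨fun h => c.symm h, fun h => c.symm h⟩
      simp [Matrix.mul_apply, this, eq_comm]
    rw [this]
    exact Matrix.posSemidef_self_mul_conjTranspose _
  diag_eq_one i := by simp
  edge_nonneg i j _ _ := by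
    simp only [Matrix.of_apply]
    split_ifs <;> norm_num

variable {G}

lemma IsOptimalSolution.agreement_le {Xs : Matrix (Fin n) (Fin n) ℝ} (h : G.IsOptimalSolution Xs)
    (c : Setoid (Fin n)) : G.agreement c ≤ G.cost.traceInner Xs := by
  classical
  refine le_of_eq_of_le ?_ (h.le_of_feasible _ (G.feasible_clustering c))
  rw [agreement_eq_sum, cost_traceInner]
  simp

lemma IsOptimalSolution.opt_le {Xs : Matrix (Fin n) (Fin n) ℝ} (h : G.IsOptimalSolution Xs) :
    G.opt ≤ G.cost.traceInner Xs :=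
  ciSup_le h.agreement_le

lemma IsOptimalSolution.cost_nonneg {Xs : Matrix (Fin n) (Fin n) ℝ}
    (h : G.IsOptimalSolution Xs) : 0 ≤ G.cost.traceInner Xs := by
  classical
  refine le_trans ?_ (h.agreement_le ⊥)
  rw [agreement_eq_sum]
  refine Finset.sum_nonneg fun i _ => Finset.sum_nonneg fun j _ => ?_
  have h1 := G.adjMinus_nonneg i j
  have h2 := G.adjPlus_nonneg i j
  split_ifs <;> simp [h1, h2]

variable (G)

lemma err_nonneg (X : Matrix (Fin n) (Fin n) ℝ) : 0 ≤ G.err X := by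
  unfold err
  exact Finset.le_max' _ _ (Finset.mem_insert_self _ _)

lemma neg_apply_le_err (X : Matrix (Fin n) (Fin n) ℝ) {i j : Fin n} (h : G.graph.Adj i j)
    (hij : i < j) : -X i j ≤ G.err X := by
  unfold err
  refine Finset.le_max' _ _ (Finset.mem_insert_of_mem ?_)
  rw [Finset.mem_image]
  exact ⟨(i, j), by simp [h, hij], rfl⟩

lemma err_le {X : Matrix (Fin n) (Fin n) ℝ} {ε : ℝ} (hε : 0 ≤ ε)
    (h : ∀ i j, G.graph.Adj i j → i < j → -ε ≤ X i j) : G.err X ≤ ε := by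
  classical
  refine Finset.max'_le _ _ _ fun x hx => ?_
  rcases Finset.mem_insert.1 hx with rfl | hx
  · exact hε
  · obtain ⟨⟨i, j⟩, hp, rfl⟩ := Finset.mem_image.1 hx
    have := (Finset.mem_filter.1 hp).2
    linarith [h i j this.1 this.2]

/-- `err` inspects only i < j; symmetry covers the other order. This nonnegativity makes the angle
acute. -/
lemma add_err_nonneg {X : Matrix (Fin n) (Fin n) ℝ} (hX : X.PosSemidef) {i j : Fin n}
    (h : G.graph.Adj i j) : 0 ≤ X i j + G.err X := by
  rcases lt_or_gt_of_ne h.ne with hij | hij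
  · linarith [G.neg_apply_le_err X h hij]
  · have hs : X j i = X i j := by simpa using hX.1.apply i j
    linarith [G.neg_apply_le_err X h.symm hij]

lemma diag_add_err_le_repairScale (X : Matrix (Fin n) (Fin n) ℝ) (i : Fin n) :
    X i i + G.err X ≤ G.repairScale X :=
  add_le_add_left (le_ciSup (f := fun i => X i i) (Set.finite_range _).bddAbove i) _

lemma noiseCov_posSemidef {X : Matrix (Fin n) (Fin n) ℝ} (hm : 0 ≤ G.repairScale X) :
    (G.noiseCov X).PosSemidef := by
  rw [noiseCov, ← Matrix.diagonal_one, Matrix.diagonal_sub]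
  refine Matrix.PosSemidef.diagonal fun i => ?_
  simp only [Pi.zero_apply, sub_nonneg]
  exact div_le_one_of_le₀ (G.diag_add_err_le_repairScale X i) hm

variable {G}

/-! ### From single pairs to the expected value -/

/-- Probabilistic guarantee for a single ordered pair: the probability of the common cluster is at
least `0.766` of the repaired correlation, and likewise for the complements. -/
lemma sameCluster_bounds {X : Matrix (Fin n) (Fin n) ℝ} (hX : X.PosSemidef)
    (hm : 0 < G.repairScale X) {i j : Fin n} (h : G.graph.Adj i j) :
    0.766 * ((X i j + G.err X) / G.repairScale X) ≤
        (G.randomnessLaw X).real (G.sameClusterSet X i j) ∧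
      0.766 * (1 - (X i j + G.err X) / G.repairScale X) ≤
        1 - (G.randomnessLaw X).real (G.sameClusterSet X i j) := by
  have h0 : 0 ≤ (X i j + G.err X) / G.repairScale X := div_nonneg (G.add_err_nonneg hX h) hm.le
  have h1 : (X i j + G.err X) / G.repairScale X ≤ 1 := by
    refine div_le_one_of_le₀ ?_ hm.le
    linarith [hX.two_mul_apply_le i j, G.diag_add_err_le_repairScale X i,
      G.diag_add_err_le_repairScale X j]
  have hcos := Real.cos_arccos (by linarith) h1
  have ht0 := Real.arccos_nonneg ((X i j + G.err X) / G.repairScale X)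
  have ht1 := Real.arccos_le_pi_div_two.2 h0
  rw [G.randomnessLaw_sameClusterSet hX (G.noiseCov_posSemidef hm.le) hm (G.err_nonneg X) h.ne
    ht0 ht1 hcos.symm]
  refine ⟨?_, ?_⟩
  · have := roundingProb_ge ht0 ht1
    rwa [hcos] at this
  · have := one_sub_roundingProb_ge ht0 ht1
    rwa [hcos] at this

/-- The repair only helps edgewise: on similar pairs `err` raises the correlation, and on dissimilar
pairs X i i + err ≤ m gives (X i i - X i j)/m ≤ 1 - (X i j + err)/m. -/
lemma sum_sameCluster_ge {X : Matrix (Fin n) (Fin n) ℝ} (hX : X.PosSemidef)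
    (hm : 0 < G.repairScale X) :
    0.766 * (G.cost.traceInner X / G.repairScale X) ≤
      ∑ i, ∑ j, (G.adjMinus i j * (1 - (G.randomnessLaw X).real (G.sameClusterSet X i j)) +
        G.adjPlus i j * (G.randomnessLaw X).real (G.sameClusterSet X i j)) := by
  rw [cost_traceInner, Finset.sum_div, Finset.mul_sum]
  refine Finset.sum_le_sum fun i _ => ?_
  rw [Finset.sum_div, Finset.mul_sum]
  refine Finset.sum_le_sum fun j _ => ?_
  have hminus : 0.766 * (G.adjMinus i j * ((X i i - X i j) / G.repairScale X)) ≤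
      G.adjMinus i j * (1 - (G.randomnessLaw X).real (G.sameClusterSet X i j)) := by
    by_cases h : G.minus.Adj i j
    · have hb := (sameCluster_bounds hX hm (G := G) (Or.inr h : G.graph.Adj i j)).2
      have : (X i i - X i j) / G.repairScale X ≤ 1 - (X i j + G.err X) / G.repairScale X := by
        rw [le_sub_iff_add_le, ← add_div]
        refine div_le_one_of_le₀ ?_ hm.le
        linarith [G.diag_add_err_le_repairScale X i]
      rw [mul_left_comm]
      exact mul_le_mul_of_nonneg_left (by linarith) (G.adjMinus_nonneg i j)
    · simp [adjMinus, h]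
  have hplus : 0.766 * (G.adjPlus i j * (X i j / G.repairScale X)) ≤
      G.adjPlus i j * (G.randomnessLaw X).real (G.sameClusterSet X i j) := by
    by_cases h : G.plus.Adj i j
    · have hb := (sameCluster_bounds hX hm (G := G) (Or.inl h : G.graph.Adj i j)).1
      have : X i j / G.repairScale X ≤ (X i j + G.err X) / G.repairScale X := by
        gcongr
        linarith [G.err_nonneg X]
      rw [mul_left_comm]
      exact mul_le_mul_of_nonneg_left (by linarith) (G.adjPlus_nonneg i j)
    · simp [adjPlus, h]
  refine le_trans (le_of_eq ?_) (add_le_add hminus hplus)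
  ring

/-- Scaling back by the repair factor costs at most a factor `1 - 6ε`. -/
lemma le_cost_div_repairScale {X : Matrix (Fin n) (Fin n) ℝ} {ε v : ℝ} (hε0 : 0 < ε)
    (hε : ε < 1 / 6) (hv : 0 ≤ v) (hlower : (1 - 4 * ε) * v ≤ G.cost.traceInner X)
    (hdiag : ∀ i, |X i i - 1| ≤ ε)
    (hedge : ∀ i j, G.graph.Adj i j → i < j → -ε ≤ X i j) (hn : Nonempty (Fin n)) :
    0 < G.repairScale X ∧ (1 - 6 * ε) * v ≤ G.cost.traceInner X / G.repairScale X := by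
  have hm : 0 < G.repairScale X := by
    obtain ⟨i⟩ := hn
    linarith [G.diag_add_err_le_repairScale X i, (abs_le.1 (hdiag i)).1, G.err_nonneg X]
  have hm2 : G.repairScale X ≤ 1 + 2 * ε := by
    have : (⨆ i, X i i) ≤ 1 + ε := ciSup_le fun i => by linarith [(abs_le.1 (hdiag i)).2]
    rw [repairScale]
    linarith [G.err_le hε0.le hedge]
  refine ⟨hm, ?_⟩
  rw [le_div_iff₀ hm]
  have h6 : 0 ≤ (1 - 6 * ε) * v := mul_nonneg (by linarith) hv
  calc (1 - 6 * ε) * v * G.repairScale X ≤ (1 - 6 * ε) * v * (1 + 2 * ε) := by gcongr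
    -- (1 - 6ε)(1 + 2ε) = 1 - 4ε - 12ε².
    _ ≤ (1 - 4 * ε) * v := by nlinarith [mul_nonneg hv (sq_nonneg ε)]
    _ ≤ _ := hlower

/-- Expected agreement as a sum over ordered pairs. -/
lemma integral_agreement {Ω : Type*} [MeasurableSpace Ω] {P : Measure Ω} [IsProbabilityMeasure P]
    {X : Matrix (Fin n) (Fin n) ℝ} {W : Ω → (Fin 3 → EuclideanSpace ℝ (Fin n)) × (Fin 3 → ℝ) ×
      (Fin 3 → EuclideanSpace ℝ (Fin n)) × ℕ} (hW : HasLaw W (G.randomnessLaw X) P)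
    {value : Ω → ℝ}
    (hvalue : ∀ ω, value ω = G.agreement (signClustering (W ω).2.2.2
      fun l => G.repair X ((W ω).1 l) ((W ω).2.1 l) ((W ω).2.2.1 l))) :
    Integrable value P ∧ ∫ ω, value ω ∂P =
      ∑ i, ∑ j, (G.adjMinus i j * (1 - (G.randomnessLaw X).real (G.sameClusterSet X i j)) +
        G.adjPlus i j * (G.randomnessLaw X).real (G.sameClusterSet X i j)) := by
  classical
  have hv : value = fun ω => ∑ i, ∑ j,
      (G.adjMinus i j * (1 - (W ⁻¹' G.sameClusterSet X i j).indicator (fun _ => (1 : ℝ)) ω) +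
        G.adjPlus i j * (W ⁻¹' G.sameClusterSet X i j).indicator (fun _ => (1 : ℝ)) ω) := by
    funext ω
    rw [hvalue, agreement_eq_sum]
    rfl
  have hms : ∀ i j, NullMeasurableSet (W ⁻¹' G.sameClusterSet X i j) P := fun i j =>
    hW.aemeasurable.nullMeasurableSet_preimage (G.measurableSet_sameClusterSet X i j)
  have hint : ∀ i j, Integrable
      ((W ⁻¹' G.sameClusterSet X i j).indicator (fun _ => (1 : ℝ))) P := fun i j =>
    (integrable_const 1).indicator₀ (hms i j)
  have hI : ∀ i j, ∫ ω, (W ⁻¹' G.sameClusterSet X i j).indicator (fun _ => (1 : ℝ)) ω ∂P =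
      (G.randomnessLaw X).real (G.sameClusterSet X i j) := by
    intro i j
    rw [integral_indicator₀ (hms i j), setIntegral_const, smul_eq_mul, mul_one, ← hW.map_eq,
      measureReal_def, measureReal_def,
      Measure.map_apply_of_aemeasurable hW.aemeasurable (G.measurableSet_sameClusterSet X i j)]
  have hterm1 : ∀ i j, Integrable (fun ω => G.adjMinus i j *
      (1 - (W ⁻¹' G.sameClusterSet X i j).indicator (fun _ => (1 : ℝ)) ω)) P := fun i j =>
    ((integrable_const 1).sub (hint i j)).const_mul _
  have hterm2 : ∀ i j, Integrable (fun ω => G.adjPlus i j *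
      (W ⁻¹' G.sameClusterSet X i j).indicator (fun _ => (1 : ℝ)) ω) P := fun i j =>
    (hint i j).const_mul _
  have hterm : ∀ i j, Integrable (fun ω => G.adjMinus i j *
      (1 - (W ⁻¹' G.sameClusterSet X i j).indicator (fun _ => (1 : ℝ)) ω) +
      G.adjPlus i j * (W ⁻¹' G.sameClusterSet X i j).indicator (fun _ => (1 : ℝ)) ω) P :=
    fun i j => (hterm1 i j).add (hterm2 i j)
  subst hv
  refine ⟨integrable_finsetSum _ fun i _ => integrable_finsetSum _ fun j _ => hterm i j, ?_⟩
  rw [integral_finsetSum _ fun i _ => integrable_finsetSum _ fun j _ => hterm i j]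
  refine Finset.sum_congr rfl fun i _ => ?_
  rw [integral_finsetSum _ fun j _ => hterm i j]
  refine Finset.sum_congr rfl fun j _ => ?_
  rw [integral_add (hterm1 i j) (hterm2 i j), integral_const_mul, integral_const_mul,
    integral_sub (integrable_const 1) (hint i j), hI]
  simp

end CorrelationInstance

/-- Expected value of the clustering obtained from a near-optimal, near-feasible matrix `Xhat` by
the modified repair algorithm followed by the Charikar-Guruswami-Wirth rounding scheme. -/
theorem mainTheorem8 {n : ℕ} (G : CorrelationInstance n)
    (Xstar : Matrix (Fin n) (Fin n) ℝ) (hXstar : G.IsOptimalSolution Xstar)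
    (ε : ℝ) (hε0 : 0 < ε) (hε : ε < 1 / 6)
    (Xhat : Matrix (Fin n) (Fin n) ℝ) (hpsd : Xhat.PosSemidef)
    (hlower : (1 - 4 * ε) * G.cost.traceInner Xstar ≤ G.cost.traceInner Xhat)
    (hupper : G.cost.traceInner Xhat ≤ (1 + 4 * ε) * G.cost.traceInner Xstar)
    (hdiag : ∀ i, |Xhat i i - 1| ≤ ε)
    (hedge : ∀ i j, G.graph.Adj i j → i < j → -ε ≤ Xhat i j)
    {Ω : Type*} [MeasurableSpace Ω] (P : Measure Ω) [IsProbabilityMeasure P]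
    (z : Fin 3 → Ω → EuclideanSpace ℝ (Fin n)) (y : Fin 3 → Ω → ℝ)
    (ζ : Fin 3 → Ω → EuclideanSpace ℝ (Fin n)) (k : Ω → ℕ)
    (hlaw : HasLaw (fun ω => (fun l => z l ω, fun l => y l ω, fun l => ζ l ω, k ω))
      (G.randomnessLaw Xhat) P)
    (zf : Fin 3 → Ω → EuclideanSpace ℝ (Fin n))
    (hzf : ∀ l ω, zf l ω = G.repair Xhat (z l ω) (y l ω) (ζ l ω))
    (value : Ω → ℝ)
    (hvalue : ∀ ω, value ω =
      G.agreement (CorrelationInstance.signClustering (k ω) fun l => zf l ω)) :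
    Integrable value P ∧
      0.766 * (1 - 6 * ε) * G.cost.traceInner Xstar ≤ ∫ ω, value ω ∂P ∧
      0.766 * (1 - 6 * ε) * G.opt ≤ 0.766 * (1 - 6 * ε) * G.cost.traceInner Xstar := by
  have hopt := hXstar.opt_le
  obtain ⟨hint, heq⟩ := CorrelationInstance.integral_agreement (value := value) hlaw
    (fun ω => by rw [hvalue]; simp only [hzf])
  refine ⟨hint, ?_, mul_le_mul_of_nonneg_left hopt (by linarith)⟩
  rw [heq]
  -- Without vertices the repair scale is 0 and cannot be divided out, but both sides are empty
  -- sums.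
  rcases isEmpty_or_nonempty (Fin n) with hn | hn
  · simp [CorrelationInstance.cost_traceInner]
  · obtain ⟨hm, hle⟩ := CorrelationInstance.le_cost_div_repairScale hε0 hε hXstar.cost_nonneg
      hlower hdiag hedge hn
    refine le_trans ?_ (CorrelationInstance.sum_sameCluster_ge hpsd hm)
    rw [mul_assoc]
    exact mul_le_mul_of_nonneg_left hle (by norm_num)
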